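/- Let $X$ be a reflexive real Banach space and let $Z\neq\{0\}$ be a real Hausdorff locally convex topological vector space. Let $C\subseteq Z$ be a convex pointed cone (that is, $tc\in C$ for all $c\in C$, $t\ge 0$; $C+C=C$; $C\cap(-C)=\{0\}$) with nonempty interior $\operatorname{int} C$. Let $K\subseteq X$ be nonempty, convex and closed, and let $D\subseteq K$ be self-segment-dense in $K$ in the weak topology of $X$, that is, $D$ is weakly dense in $K$ and for all $x,y\in D$ the set $[x,y]\cap D$ is weakly dense in the segment $[x,y]$. A map $g:K\to Z$ is called weakly $C$-upper semicontinuous at $x\in K$ if for every neighbourhood $V$ of $g(x)$ there is a weak neighbourhood $U$ of $x$ such that $g(u)\in V-C$ for all $u\in U\cap K$. It is called $C$-convex on $K$ if $\sum_{i=1}^n\lambda_i g(x_i)-g\bigl(\sum_{i=1}^n\lambda_i x_i\bigr)\in C$ for all $n\ge 1$, $x_1,\dots,x_n\in K$ and $\lambda_1,\dots,\lambda_n\ge 0$ with $\sum_{i=1}^n\lambda_i=1$. Let $f:K\times K\to Z$ satisfy: (i) for every $y\in D$, the map $x\mapsto f(x,y)$ is weakly $C$-upper semicontinuous at every point of $K$;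 (ii) for every $x\in K$, the map $y\mapsto f(x,y)$ on $K$ is weakly $C$-upper semicontinuous at every point of $K\setminus D$; (iii) for every $x\in K$, the map $y\mapsto f(x,y)$ is $C$-convex on $K$; (iv) $f(x,x)=0$ for every $x\in K$; (v) there exists $r>0$ such that for every $x\in K$ with $\|x\|>r$ there exists $y_0\in K$ with $\|y_0\|<\|x\|$ and $f(x,y_0)\in-\operatorname{int} C\cup\{0\}$. Then there exists $x_0\in K$ such that $f(x_0,y)\notin-\operatorname{int} C$ for all $y\in K$. -/

import Mathlib

open Topology
open scoped Pointwise

/-- A normed space is reflexive if the canonical isometric embedding into its topological bidual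
is onto. -/
def IsReflexiveNormedSpace (X : Type*) [NormedAddCommGroup X] [NormedSpace ℝ X] : Prop :=
  Function.Surjective (NormedSpace.inclusionInDoubleDual ℝ X)

/-- `U` is self-segment-dense in the (convex) set `V`: it is a subset of `V`, it is dense in `V`,
and for any two points of `U` the segment joining them has a dense set of points in `U`. -/
structure SelfSegmentDense {E : Type*} [AddCommGroup E] [Module ℝ E] [TopologicalSpace E]
    (U V : Set E) : Prop where
  subset : U ⊆ V
  dense : V ⊆ closure U
  segment_dense : ∀ x ∈ U, ∀ y ∈ U, segment ℝ x y ⊆ closure (segment ℝ x y ∩ U)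

/-- A map `g`, regarded as a map with domain `K`, is `C`-upper semicontinuous at `x`: for every
neighbourhood `V` of `g x` there is a neighbourhood `U` of `x` with `g u ∈ V - C` for all
`u ∈ U ∩ K`. -/
def CUpperSemicontinuousAt {E Z : Type*} [TopologicalSpace E] [TopologicalSpace Z] [Sub Z]
    (C : Set Z) (K : Set E) (g : E → Z) (x : E) : Prop :=
  ∀ V ∈ 𝓝 (g x), ∃ U ∈ 𝓝 x, ∀ u ∈ U ∩ K, g u ∈ V - C

/-- `CUpperSemicontinuousAt` for the weak topology of a normed space `X`. -/
def WeaklyCUpperSemicontinuousAt {X Z : Type*} [NormedAddCommGroup X] [NormedSpace ℝ X]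
    [TopologicalSpace Z] [Sub Z] (C : Set Z) (K : Set X) (g : X → Z) (x : X) : Prop :=
  CUpperSemicontinuousAt C (toWeakSpace ℝ X '' K) (fun w => g ((toWeakSpace ℝ X).symm w))
    (toWeakSpace ℝ X x)

/-- `g` is `C`-convex on `S` (which need not be convex), for the order in which `z₁ ≤ z₂` means
`z₂ - z₁ ∈ C`. -/
def CConvexOn {E Z : Type*} [AddCommGroup E] [Module ℝ E] [AddCommGroup Z] [Module ℝ Z]
    (C : Set Z) (S : Set E) (g : E → Z) : Prop :=
  ∀ (n : ℕ) (x : Fin n → E) (l : Fin n → ℝ), (∀ i, x i ∈ S) → (∀ i, 0 ≤ l i) →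
    ∑ i, l i = 1 → ∑ i, l i • x i ∈ S →
      ∑ i, l i • g (x i) - g (∑ i, l i • x i) ∈ C

/-! Intersect `K` with a closed ball of radius `R > r`; by reflexivity the result is weakly compact.
On it the Ky Fan principle `IsCompact.exists_forall_not` gives `x₀` with `f x₀ y ∉ -interior C` for
all `y ∈ D` in the open ball: (i) makes the bad sets relatively weakly open, and `C`-convexity with
`f x x = 0` gives the KKM condition.

Self-segment-density makes `D` norm dense in `K` (`SelfSegmentDense.subset_norm_closure`), so (ii)
extends this to all `y ∈ K` in the open ball. Coercivity then provides `y₀` inside the open ball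
with `f x₀ y₀ = 0`. If some `y ∈ K` had `f x₀ y ∈ -interior C`, so would the points of the segment
from `y₀` to `y` close to `y₀`, which lie in the ball.

The Ky Fan principle comes from the KKM lemma, and that from Scarf's combinatorial lemma on a fine
grid in the simplex, proved by a parity argument. -/

/-! ### Scarf's lemma on dominant sets. -/

section Scarf

variable {U I α : Type*} [LinearOrder α]

/-- A finite set is dominant for a family of orders if no point is strictly above its minimum
in all of the orders. -/
def IsDominant (r : I → U → α) (S : Finset U) : Prop :=
  ∀ y, ∃ i, ∀ x ∈ S, r i y ≤ r i x

theorem IsDominant.mono {r : I → U → α} {S S' : Finset U} (h : IsDominant r S) (hS : S' ⊆ S) :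
    IsDominant r S' := fun y => (h y).imp fun _ hi x hx => hi x (hS hx)

theorem exists_minimizers (r : I → U → α) {S : Finset U} (hS : S.Nonempty) :
    ∃ m : I → U, (∀ i, m i ∈ S) ∧ ∀ i, ∀ x ∈ S, r i (m i) ≤ r i x := by
  choose m hm using fun i => S.exists_min_image (r i) hS
  exact ⟨m, fun i => (hm i).1, fun i => (hm i).2⟩

/-- Dominance tested at a point of the set itself makes that point least in some order. Thus a
dominant set has at most as many points as there are orders. -/
theorem IsDominant.exists_eq_minimizer {r : I → U → α} (hr : ∀ i, Function.Injective (r i))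
    {S : Finset U} (h : IsDominant r S) {m : I → U} (hmS : ∀ i, m i ∈ S)
    (hm : ∀ i, ∀ x ∈ S, r i (m i) ≤ r i x) {t : U} (ht : t ∈ S) : ∃ i, m i = t := by
  obtain ⟨i, hi⟩ := h t
  exact ⟨i, hr i (le_antisymm (hm i t ht) (hi _ (hmS i)))⟩

open scoped Classical

/-- If the orders other than `k` have distinct minimizers on `S` which exhaust `S`, the points
extending `S` to a dominant set by becoming its minimum for the order `k` are the `k`-maximal ones
above the other minima. -/
theorem IsDominant.insert_iff {r : I → U → α} (hr : ∀ i, Function.Injective (r i))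
    {S : Finset U} (h : IsDominant r S) {m : I → U}
    (hmS : ∀ i, m i ∈ S) (hm : ∀ i, ∀ x ∈ S, r i (m i) ≤ r i x)
    {k : I} (hk : ∀ t ∈ S, ∃ l, l ≠ k ∧ m l = t)
    (hinj : ∀ a b, a ≠ k → b ≠ k → m a = m b → a = b) (x : U) :
    (x ∉ S ∧ IsDominant r (insert x S) ∧ r k x < r k (m k)) ↔
      (∀ l, l ≠ k → r l (m l) < r l x) ∧
        ∀ y, (∀ l, l ≠ k → r l (m l) < r l y) → r k y ≤ r k x := by
  constructor
  · rintro ⟨hxS, hd, hxk⟩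
    constructor
    · intro l hl
      obtain ⟨i, hi⟩ := hd (m l)
      have hil : m i = m l := hr i (le_antisymm (hm i _ (hmS l))
        (hi _ (Finset.mem_insert_of_mem (hmS i))))
      have hix := hi x (Finset.mem_insert_self _ _)
      have hik : i ≠ k := by
        rintro rfl
        exact absurd hxk (not_lt.2 (hil ▸ hix))
      obtain rfl := hinj i l hik hl hil
      exact lt_of_le_of_ne hix fun he => hxS (hr i he ▸ hmS i)
    · intro y hy
      obtain ⟨i, hi⟩ := hd y
      by_cases hik : i = k
      · subst hik; exact hi x (Finset.mem_insert_self _ _)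
      · exact absurd (hi (m i) (Finset.mem_insert_of_mem (hmS i))) (not_le.2 (hy i hik))
  · rintro ⟨h1, h2⟩
    have hxS : x ∉ S := by
      intro hx
      obtain ⟨l, hl, rfl⟩ := hk x hx
      exact lt_irrefl _ (h1 l hl)
    -- By dominance `x` cannot exceed the minimum in every order, and `k` is the only order left.
    have hxk : r k x < r k (m k) := by
      obtain ⟨i, hi⟩ := h x
      have hik : i = k := by
        by_contra hik
        exact absurd (hi _ (hmS i)) (not_le.2 (h1 i hik))
      subst hik
      exact lt_of_le_of_ne (hi _ (hmS i)) fun he => hxS (hr i he ▸ hmS i)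
    refine ⟨hxS, ?_, hxk⟩
    intro y
    by_contra! hcon
    have hy : ∀ l, l ≠ k → r l (m l) < r l y := by
      intro l hl
      obtain ⟨z, hz, hzy⟩ := hcon l
      rcases Finset.mem_insert.1 hz with rfl | hz
      · exact (h1 l hl).trans hzy
      · exact (hm l z hz).trans_lt hzy
    obtain ⟨z, hz, hzy⟩ := hcon k
    have hzx := hzy.trans_le (h2 y hy)
    rcases Finset.mem_insert.1 hz with rfl | hz
    · exact lt_irrefl _ hzx
    · exact absurd (hzx.trans hxk) (not_lt.2 (hm k z hz))

/-- A new point of a dominant set becomes the minimum for exactly one of the two orders which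
shared their minimizer. -/
theorem IsDominant.insert_lt_minimizer {r : I → U → α} (hr : ∀ i, Function.Injective (r i))
    {S : Finset U} {m : I → U}
    (hmS : ∀ i, m i ∈ S) (hm : ∀ i, ∀ x ∈ S, r i (m i) ≤ r i x) {i j : I} (hij : i ≠ j)
    (hi : ∀ k l, k ≠ i → l ≠ i → m k = m l → k = l)
    (hj : ∀ k l, k ≠ j → l ≠ j → m k = m l → k = l)
    {x : U} (hx : x ∉ S) (hd : IsDominant r (insert x S)) :
    (r i x < r i (m i) ∨ r j x < r j (m j)) ∧ ¬ (r i x < r i (m i) ∧ r j x < r j (m j)) := by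
  -- Dominance of the enlarged set, tested at the old minimizer `m k`, leaves it minimal in some
  -- order. So `x` cannot displace a minimizer from all its orders: it displaces the shared one from
  -- one order only, and no other at all.
  have old : ∀ k, ∃ a, m a = m k ∧ ¬ r a x < r a (m a) := by
    intro k
    obtain ⟨a, ha⟩ := hd (m k)
    have hak : m a = m k := hr a (le_antisymm (hm a _ (hmS k))
      (ha _ (Finset.mem_insert_of_mem (hmS a))))
    exact ⟨a, hak, not_lt.2 (hak ▸ ha x (Finset.mem_insert_self _ _))⟩
  constructor
  · obtain ⟨k, hk⟩ := hd x
    have hkx : r k x < r k (m k) := lt_of_le_of_ne (hk _ (Finset.mem_insert_of_mem (hmS k)))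
      fun he => hx (hr k he ▸ hmS k)
    by_cases hki : k = i
    · exact Or.inl (hki ▸ hkx)
    by_cases hkj : k = j
    · exact Or.inr (hkj ▸ hkx)
    obtain ⟨a, hak, hax⟩ := old k
    by_cases hai : a = i
    · by_cases haj : a = j
      · exact absurd (hai.symm.trans haj) hij
      · exact absurd hkx (hj a k haj hkj hak ▸ hax)
    · exact absurd hkx (hi a k hai hki hak ▸ hax)
  · rintro ⟨h1, h2⟩
    obtain ⟨a, hai, hax⟩ := old i
    by_cases haj : a = j
    · exact hax (haj ▸ h2)
    · exact hax (hj a i haj hij hai ▸ h1)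

variable [Fintype I]

/-- In a dominant set with one point less than there are orders, exactly two orders share their
minimizer. -/
theorem IsDominant.exists_collision {r : I → U → α} (hr : ∀ i, Function.Injective (r i))
    {S : Finset U} (h : IsDominant r S) (hcard : S.card + 1 = Fintype.card I) {m : I → U}
    (hmS : ∀ i, m i ∈ S) (hm : ∀ i, ∀ x ∈ S, r i (m i) ≤ r i x) :
    ∃ i j, i ≠ j ∧ m i = m j ∧ (∀ k l, k ≠ i → l ≠ i → m k = m l → k = l) ∧
      (∀ k l, k ≠ j → l ≠ j → m k = m l → k = l) := by
  obtain ⟨i, -, j, -, hij, hmij⟩ := Finset.exists_ne_map_eq_of_card_lt_of_maps_to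
    (s := Finset.univ) (t := S) (f := m) (by rw [Finset.card_univ]; omega) (fun i _ => hmS i)
  -- Without one of two colliding orders the minimizers still exhaust `S`, now with as many orders
  -- as points, hence injectively.
  have key : ∀ a b, a ≠ b → m a = m b → ∀ k l, k ≠ a → l ≠ a → m k = m l → k = l := by
    intro a b hab hmab k l hk hl hkl
    have hsurj : Set.SurjOn m (Finset.univ.erase a : Finset I) S := by
      intro t ht
      obtain ⟨c, hc⟩ := h.exists_eq_minimizer hr hmS hm ht
      by_cases hca : c = a
      · exact ⟨b, by simpa using hab.symm, by rw [← hmab, ← hca, hc]⟩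
      · exact ⟨c, by simpa using hca, hc⟩
    have hinj := Finset.injOn_of_surjOn_of_card_le m (s := Finset.univ.erase a) (t := S)
      (fun i _ => hmS i) hsurj (by
        rw [Finset.card_erase_of_mem (Finset.mem_univ _), Finset.card_univ]; omega)
    exact hinj (by simpa using hk) (by simpa using hl) hkl
  exact ⟨i, j, hij, hmij, key i j hij hmij, key j i hij.symm hmij.symm⟩

/-- Slack points: `s i` is the least point of the order `i` and lies above all points which are not
slack points in the other orders. -/
structure IsSlack (r : I → U → α) (s : I → U) : Prop where
  le : ∀ i u, r i (s i) ≤ r i u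
  lt : ∀ i j, j ≠ i → ∀ u, u ∉ Set.range s → r i u < r i (s j)

theorem IsSlack.isDominant {r : I → U → α} {s : I → U} (hs : IsSlack r s) (i₀ : I) :
    IsDominant r ((Finset.univ.erase i₀).image s) := by
  intro y
  by_cases hy : y ∈ Set.range s
  · obtain ⟨b, rfl⟩ := hy
    exact ⟨b, fun x _ => hs.le b x⟩
  · refine ⟨i₀, fun x hx => ?_⟩
    obtain ⟨j, hj, rfl⟩ := Finset.mem_image.1 hx
    exact (hs.lt i₀ j (by simpa using hj) y hy).le

/-- A set with as many points as there are colours, not all of which occur, has an even number of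
facets showing exactly the colours other than `i₀`. -/
theorem even_card_facets (c : U → I) (i₀ : I) {S : Finset U} (hcard : S.card = Fintype.card I)
    (hc : S.image c ≠ Finset.univ) :
    Even (S.filter fun x => (S.erase x).image c = Finset.univ.erase i₀).card := by
  rcases Finset.eq_empty_or_nonempty
    (S.filter fun x => (S.erase x).image c = Finset.univ.erase i₀) with h0 | ⟨x, hx⟩
  · rw [h0]; simp
  obtain ⟨hxS, hx⟩ := Finset.mem_filter.1 hx
  have inj : ∀ y ∈ S, (S.erase y).image c = Finset.univ.erase i₀ →
      Set.InjOn c (S.erase y : Finset U) := by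
    intro y hy h
    rw [← Finset.card_image_iff, h, Finset.card_erase_of_mem (Finset.mem_univ _),
      Finset.card_erase_of_mem hy, hcard, Finset.card_univ]
  have ins : ∀ y ∈ S, S.image c = insert (c y) ((S.erase y).image c) := by
    intro y hy
    rw [← Finset.image_insert, Finset.insert_erase hy]
  have hci : c x ≠ i₀ := by
    intro h
    apply hc
    rw [ins x hxS, hx, h, Finset.insert_erase (Finset.mem_univ _)]
  have : c x ∈ (S.erase x).image c := by rw [hx]; simpa using hci
  -- Exactly one colour is repeated, at `x` and `y`; the required facets are those omitting one of
  -- these two.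
  obtain ⟨y, hy, hyx⟩ := Finset.mem_image.1 this
  obtain ⟨hyx', hyS⟩ := Finset.mem_erase.1 hy
  have himg : S.image c = Finset.univ.erase i₀ := by
    rw [ins x hxS, Finset.insert_eq_self.2 this, hx]
  suffices S.filter (fun x => (S.erase x).image c = Finset.univ.erase i₀) = {x, y} by
    rw [this, Finset.card_pair (Ne.symm hyx')]
    exact even_two
  ext z
  simp only [Finset.mem_filter, Finset.mem_insert, Finset.mem_singleton]
  constructor
  · rintro ⟨hz, hz'⟩
    by_contra! hcon
    exact hyx' (inj z hz hz' (by simpa using ⟨hyS, Ne.symm hcon.2⟩)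
      (by simpa using ⟨hxS, Ne.symm hcon.1⟩) hyx)
  · rintro (rfl | rfl)
    · exact ⟨hxS, hx⟩
    · refine ⟨hyS, ?_⟩
      rw [← himg, ins z hyS, eq_comm, Finset.insert_eq_self, hyx]
      exact Finset.mem_image_of_mem c (Finset.mem_erase.2 ⟨Ne.symm hyx', hxS⟩)

variable [Fintype U]

theorem card_filter_maximal {β : U → α} (hβ : Function.Injective β) (P : U → Prop)
    [Decidable (∃ x, P x)] [DecidablePred fun x => P x ∧ ∀ y, P y → β y ≤ β x] :
    (Finset.univ.filter fun x => P x ∧ ∀ y, P y → β y ≤ β x).card = if ∃ x, P x then 1 else 0 := by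
  split_ifs with h
  · obtain ⟨x, hx, hmax⟩ := (Finset.univ.filter P).exists_max_image β
      (h.imp fun x hx => by simpa using hx)
    rw [Finset.card_eq_one]
    refine ⟨x, Finset.ext fun z => ?_⟩
    simp only [Finset.mem_filter, Finset.mem_univ, true_and, Finset.mem_singleton] at *
    constructor
    · rintro ⟨hz, hz'⟩
      exact hβ (le_antisymm (hmax z hz) (hz' x hx))
    · rintro rfl
      exact ⟨hx, hmax⟩
  · rw [Finset.card_eq_zero, Finset.filter_eq_empty_iff]
    rintro x - ⟨hx, -⟩
    exact h ⟨x, hx⟩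

/-- The number of dominant one-point extensions of a dominant set with one point less than there
are orders. -/
theorem IsDominant.card_extensions {r : I → U → α} (hr : ∀ i, Function.Injective (r i))
    {S : Finset U} (h : IsDominant r S) {m : I → U}
    (hmS : ∀ i, m i ∈ S) (hm : ∀ i, ∀ x ∈ S, r i (m i) ≤ r i x) {i j : I} (hij : i ≠ j)
    (hmij : m i = m j)
    (hi : ∀ k l, k ≠ i → l ≠ i → m k = m l → k = l)
    (hj : ∀ k l, k ≠ j → l ≠ j → m k = m l → k = l) :
    (Finset.univ.filter fun x => x ∉ S ∧ IsDominant r (insert x S)).card =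
      (if ∃ x, ∀ l, l ≠ i → r l (m l) < r l x then 1 else 0) +
      (if ∃ x, ∀ l, l ≠ j → r l (m l) < r l x then 1 else 0) := by
  have cover : ∀ a b, a ≠ b → m a = m b → ∀ t ∈ S, ∃ l, l ≠ a ∧ m l = t := by
    intro a b hab hmab t ht
    obtain ⟨l, hl⟩ := h.exists_eq_minimizer hr hmS hm ht
    by_cases hla : l = a
    · exact ⟨b, hab.symm, by rw [← hmab, ← hla, hl]⟩
    · exact ⟨l, hla, hl⟩
  have hiI := h.insert_iff hr hmS hm (cover i j hij hmij) hi
  have hjI := h.insert_iff hr hmS hm (cover j i hij.symm hmij.symm) hj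
  rw [← card_filter_maximal (hr i) fun x => ∀ l, l ≠ i → r l (m l) < r l x,
    ← card_filter_maximal (hr j) fun x => ∀ l, l ≠ j → r l (m l) < r l x, ← Finset.card_union_of_disjoint]
  · congr 1
    ext x
    simp only [Finset.mem_union, Finset.mem_filter, Finset.mem_univ, true_and, ← hiI, ← hjI]
    constructor
    · rintro ⟨hx, hd⟩
      exact (insert_lt_minimizer hr hmS hm hij hi hj hx hd).1.imp
        (fun h => ⟨hx, hd, h⟩) (fun h => ⟨hx, hd, h⟩)
    · rintro (⟨hx, hd, -⟩ | ⟨hx, hd, -⟩) <;> exact ⟨hx, hd⟩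
  · rw [Finset.disjoint_filter]
    intro x _ h1 h2
    rw [← hiI] at h1
    rw [← hjI] at h2
    exact (insert_lt_minimizer hr hmS hm hij hi hj h1.1 h1.2.1).2 ⟨h1.2.2, h2.2.2⟩

/-- A dominant set with a point which is not a slack point has an even number of dominant
extensions. -/
theorem IsDominant.even_card_extensions {r : I → U → α} (hr : ∀ i, Function.Injective (r i))
    {s : I → U} (hs : IsSlack r s)
    {S : Finset U} (h : IsDominant r S) (hcard : S.card + 1 = Fintype.card I)
    {t : U} (ht : t ∈ S) (hts : t ∉ Set.range s) :
    Even (Finset.univ.filter fun x => x ∉ S ∧ IsDominant r (insert x S)).card := by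
  obtain ⟨m, hmS, hm⟩ := exists_minimizers r ⟨t, ht⟩
  obtain ⟨i, j, hij, hmij, hi, hj⟩ := h.exists_collision hr hcard hmS hm
  -- The slack point `s a` lies above the non-slack point `t`, hence above the minimum, in every
  -- order but `a`; so both terms of the count are 1.
  have ex : ∀ a b, a ≠ b → m a = m b → ∃ x, ∀ l, l ≠ a → r l (m l) < r l x := by
    intro a b hab hmab
    exact ⟨s a, fun l hl => (hm l t ht).trans_lt (hs.lt l a hl.symm t hts)⟩
  rw [h.card_extensions hr hmS hm hij hmij hi hj, if_pos (ex i j hij hmij),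
    if_pos (ex j i hij.symm hmij.symm)]
  exact even_two

/-- The set of all slack points but one has exactly one dominant extension. -/
theorem IsSlack.card_extensions {r : I → U → α} (hr : ∀ i, Function.Injective (r i))
    {s : I → U} (hs : IsSlack r s) (hsinj : Function.Injective s) [Nontrivial I] (i₀ : I) :
    (Finset.univ.filter fun x => x ∉ (Finset.univ.erase i₀).image s ∧
      IsDominant r (insert x ((Finset.univ.erase i₀).image s))).card = 1 := by
  have hd := hs.isDominant i₀
  set S := (Finset.univ.erase i₀).image s with hS
  have hsS : ∀ j, j ≠ i₀ → s j ∈ S := fun j hj => Finset.mem_image_of_mem s (by simpa using hj)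
  have hSs : ∀ t ∈ S, ∃ j, j ≠ i₀ ∧ s j = t := by
    intro t ht
    obtain ⟨j, hj, rfl⟩ := Finset.mem_image.1 ht
    exact ⟨j, by simpa using hj, rfl⟩
  have hcard : S.card + 1 = Fintype.card I := by
    rw [hS, Finset.card_image_of_injective _ hsinj, Finset.card_erase_of_mem (Finset.mem_univ _),
      Finset.card_univ]
    have := Fintype.card_pos_iff.2 ⟨i₀⟩
    omega
  obtain ⟨b, hb⟩ := exists_ne i₀
  obtain ⟨m, hmS, hm⟩ := exists_minimizers r ⟨s b, hsS b hb⟩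
  have hms : ∀ l, l ≠ i₀ → m l = s l := fun l hl =>
    hr l (le_antisymm (hm l _ (hsS l hl)) (hs.le l _))
  obtain ⟨i, j, hij, hmij, hi, hj⟩ := hd.exists_collision hr hcard hmS hm
  obtain ⟨a, ha, hma⟩ : ∃ a, a ≠ i₀ ∧ m i₀ = m a := by
    obtain ⟨a, ha, h⟩ := hSs _ (hmS i₀)
    exact ⟨a, ha, by rw [hms a ha, h]⟩
  have yes : ∃ x, ∀ l, l ≠ i₀ → r l (m l) < r l x := by
    refine ⟨s i₀, fun l hl => ?_⟩
    rw [hms l hl]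
    exact lt_of_le_of_ne (hs.le l _) fun he => hl (hsinj (hr l he))
  -- In the order `i₀` only slack points can exceed `s a`. But `s i₀` is least there, and no `s k`
  -- exceeds itself in the order `k`.
  have no : ¬ ∃ x, ∀ l, l ≠ a → r l (m l) < r l x := by
    rintro ⟨x, hx⟩
    have h0 := hx i₀ ha.symm
    rw [hma, hms a ha] at h0
    by_cases hxs : x ∈ Set.range s
    · obtain ⟨k, rfl⟩ := hxs
      by_cases hk : k = i₀
      · exact absurd (hs.le i₀ (s a)) (not_le.2 (hk ▸ h0))
      by_cases hka : k = a
      · exact lt_irrefl _ (hka ▸ h0)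
      · have := hx k hka
        rw [hms k hk] at this
        exact lt_irrefl _ this
    · exact absurd h0 (not_lt.2 (hs.lt i₀ a ha x hxs).le)
  rw [hd.card_extensions hr hmS hm hij hmij hi hj]
  have hcases : (i = i₀ ∧ j = a) ∨ (i = a ∧ j = i₀) := by
    by_cases h1 : i = i₀
    · left
      refine ⟨h1, ?_⟩
      by_contra h2
      exact ha (hj a i₀ (Ne.symm h2) (fun h => hij (h1.trans h)) hma.symm)
    · by_cases h2 : i = a
      · refine Or.inr ⟨h2, ?_⟩
        by_contra h3
        exact ha (hj a i₀ (fun h => hij (h2.trans h)) (Ne.symm h3) hma.symm)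
      · exact absurd (hi a i₀ (Ne.symm h2) (Ne.symm h1) hma.symm) ha
  rcases hcases with ⟨rfl, rfl⟩ | ⟨rfl, rfl⟩
  · rw [if_pos yes, if_neg no]
  · rw [if_pos yes, if_neg no]

/-- **Scarf's lemma**: if each slack point has its own colour, there is a dominant set with
one point of each colour. -/
theorem IsSlack.exists_isDominant {r : I → U → α} (hr : ∀ i, Function.Injective (r i))
    {s : I → U} (hs : IsSlack r s) [Nonempty I] (c : U → I) (hc : ∀ i, c (s i) = i) :
    ∃ S : Finset U, IsDominant r S ∧ S.card = Fintype.card I ∧ ∀ i, ∃ x ∈ S, c x = i := by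
  have hsinj : Function.Injective s := Function.LeftInverse.injective hc
  obtain ⟨i₀⟩ := ‹Nonempty I›
  rcases subsingleton_or_nontrivial I with hI | hI
  · have : Nonempty U := ⟨s i₀⟩
    obtain ⟨x, -, hx⟩ := Finset.univ.exists_max_image (r i₀) Finset.univ_nonempty
    refine ⟨{x}, fun y => ⟨i₀, by simpa using hx y (Finset.mem_univ _)⟩, ?_,
      fun i => ⟨x, by simp, Subsingleton.elim _ _⟩⟩
    rw [Finset.card_singleton, eq_comm, Fintype.card_eq_one_iff]
    exact ⟨i₀, fun y => Subsingleton.elim _ _⟩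
  by_contra! hcon
  have hpos := Fintype.card_pos_iff.2 ⟨i₀⟩
  -- Count pairs of a door and a room containing it. Without a fully coloured room the count is even
  -- by rooms; by doors it is odd, since only the slack door `S₀` has an odd number of rooms.
  let doors : Finset (Finset U) := Finset.univ.filter fun S =>
    IsDominant r S ∧ S.card + 1 = Fintype.card I ∧ S.image c = Finset.univ.erase i₀
  let rooms : Finset (Finset U) := Finset.univ.filter fun S =>
    IsDominant r S ∧ S.card = Fintype.card I
  have hcount : ∑ S ∈ doors, (Finset.univ.filter fun x =>
        x ∉ S ∧ IsDominant r (insert x S)).card =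
      ∑ S ∈ rooms, (S.filter fun x => (S.erase x).image c = Finset.univ.erase i₀).card := by
    rw [← Finset.card_sigma, ← Finset.card_sigma]
    refine Finset.card_bij' (fun p _ => ⟨insert p.2 p.1, p.2⟩) (fun p _ => ⟨p.1.erase p.2, p.2⟩)
      ?_ ?_ ?_ ?_
    · rintro ⟨S, x⟩ h
      simp only [doors, rooms, Finset.mem_sigma, Finset.mem_filter, Finset.mem_univ, true_and]
        at h ⊢
      obtain ⟨⟨-, h2, h3⟩, h4, h5⟩ := h
      refine ⟨⟨h5, by rw [Finset.card_insert_of_notMem h4, h2]⟩, Finset.mem_insert_self _ _, ?_⟩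
      rw [Finset.erase_insert h4, h3]
    · rintro ⟨S, x⟩ h
      simp only [doors, rooms, Finset.mem_sigma, Finset.mem_filter, Finset.mem_univ, true_and]
        at h ⊢
      obtain ⟨⟨h1, h2⟩, h3, h4⟩ := h
      refine ⟨⟨h1.mono (Finset.erase_subset _ _), ?_, h4⟩, Finset.notMem_erase _ _, ?_⟩
      · rw [Finset.card_erase_of_mem h3, h2]; omega
      · rwa [Finset.insert_erase h3]
    · rintro ⟨S, x⟩ h
      simp only [doors, Finset.mem_sigma, Finset.mem_filter, Finset.mem_univ, true_and] at h
      simp [Finset.erase_insert h.2.1]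
    · rintro ⟨S, x⟩ h
      simp only [rooms, Finset.mem_sigma, Finset.mem_filter, Finset.mem_univ, true_and] at h
      simp [Finset.insert_erase h.2.1]
  have heven : Even (∑ S ∈ rooms,
      (S.filter fun x => (S.erase x).image c = Finset.univ.erase i₀).card) := by
    refine Finset.even_sum _ fun S hS => ?_
    obtain ⟨h1, h2⟩ := (Finset.mem_filter.1 hS).2
    refine even_card_facets c i₀ h2 fun himg => ?_
    obtain ⟨i, hi⟩ := hcon S h1 h2
    obtain ⟨x, hx, hxi⟩ := Finset.mem_image.1 (himg ▸ Finset.mem_univ i)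
    exact hi x hx hxi
  set S₀ := (Finset.univ.erase i₀).image s with hS₀
  have himg₀ : S₀.image c = Finset.univ.erase i₀ := by
    rw [hS₀, Finset.image_image]
    rw [show c ∘ s = id from funext hc, Finset.image_id]
  have hmem : S₀ ∈ doors := by
    simp only [doors, Finset.mem_filter, Finset.mem_univ, true_and]
    refine ⟨hs.isDominant i₀, ?_, himg₀⟩
    rw [hS₀, Finset.card_image_of_injective _ hsinj, Finset.card_erase_of_mem (Finset.mem_univ _),
      Finset.card_univ]
    omega
  rw [← hcount, ← Finset.add_sum_erase _ _ hmem, hs.card_extensions hr hsinj i₀] at heven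
  have hrest : Even (∑ S ∈ doors.erase S₀, (Finset.univ.filter fun x =>
      x ∉ S ∧ IsDominant r (insert x S)).card) := by
    refine Finset.even_sum _ fun S hS => ?_
    obtain ⟨hne, hS⟩ := Finset.mem_erase.1 hS
    obtain ⟨h1, h2, h3⟩ := (Finset.mem_filter.1 hS).2
    -- Slack points carry their own index as colour, so a door made of slack points alone is `S₀`.
    obtain ⟨t, ht, hts⟩ : ∃ t ∈ S, t ∉ Set.range s := by
      by_contra! hall
      apply hne
      ext t
      simp only [hS₀, Finset.mem_image, Finset.mem_erase, Finset.mem_univ, and_true]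
      constructor
      · intro ht
        obtain ⟨i, rfl⟩ := hall t ht
        have : c (s i) ∈ S.image c := Finset.mem_image_of_mem c ht
        rw [h3, hc] at this
        exact ⟨i, by simpa using this, rfl⟩
      · rintro ⟨i, hi, rfl⟩
        have : i ∈ S.image c := by rw [h3]; simpa using hi
        obtain ⟨t, ht, hti⟩ := Finset.mem_image.1 this
        obtain ⟨j, rfl⟩ := hall t ht
        rw [hc] at hti
        exact hti ▸ ht
    exact h1.even_card_extensions hr hs h2 ht hts
  rw [Nat.even_add] at heven
  exact absurd (heven.2 hrest) (by decide)

end Scarf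

/-! ### A discrete KKM theorem. -/

section Grid

open Finset

variable {I : Type*} [Fintype I] [DecidableEq I]

/-- The points of the grid `{x : I → ℕ | ∑ i, x i = m}` together with one slack point for each
coordinate. -/
abbrev SlackGrid (I : Type*) [Fintype I] [DecidableEq I] (m : ℕ) : Type _ :=
  {x // x ∈ piAntidiag (univ : Finset I) m} ⊕ I

/-- The coordinates of the points of a grid and of the slack points. -/
def SlackGrid.coord {m : ℕ} (i : I) : SlackGrid I m → ℕ
  -- The shift places grid coordinates in `1, …, m + 1`, strictly between the two slack values `0`
  -- and `m + 2`.
  | .inl x => x.1 i + 1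
  | .inr j => if j = i then 0 else m + 2

/-- The coordinates, with ties broken by an enumeration. -/
noncomputable def SlackGrid.order {m : ℕ} (i : I) (u : SlackGrid I m) : ℕ ×ₗ ℕ :=
  toLex (coord i u, (Fintype.equivFin _ u : ℕ))

theorem SlackGrid.order_injective {m : ℕ} (i : I) :
    Function.Injective (order i : SlackGrid I m → ℕ ×ₗ ℕ) := by
  intro u v h
  have := congrArg (fun p => (ofLex p).2) h
  exact (Fintype.equivFin _).injective (Fin.ext this)

theorem SlackGrid.order_lt_of_coord_lt {m : ℕ} {i : I} {u v : SlackGrid I m}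
    (h : coord i u < coord i v) : order i u < order i v :=
  Prod.Lex.toLex_lt_toLex.2 (Or.inl h)

theorem SlackGrid.coord_le_of_order_le {m : ℕ} {i : I} {u v : SlackGrid I m}
    (h : order i u ≤ order i v) : coord i u ≤ coord i v := by
  by_contra! hlt
  exact absurd h (not_le.2 (order_lt_of_coord_lt hlt))

theorem SlackGrid.isSlack (m : ℕ) :
    IsSlack (order : I → SlackGrid I m → ℕ ×ₗ ℕ) Sum.inr where
  le i u := by
    rcases u with x | j
    · exact (order_lt_of_coord_lt (by simp [coord])).le
    · by_cases h : j = i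
      · rw [h]
      · exact (order_lt_of_coord_lt (by simp [coord, h])).le
  lt i j hj u hu := by
    rcases u with x | k
    · apply order_lt_of_coord_lt
      have hx : ∑ i, x.1 i = m := (mem_piAntidiag.1 x.2).1
      have : x.1 i ≤ ∑ i, x.1 i := single_le_sum (fun _ _ => Nat.zero_le _) (mem_univ i)
      simp only [coord, if_neg hj]
      omega
    · exact absurd ⟨k, rfl⟩ hu

/-- A discrete form of the KKM theorem: in every colouring of the points of
`{x : I → ℕ | ∑ i, x i = m}` there is a point which has points of the colours of all its large
coordinates nearby. -/
theorem exists_near_all_colours [Nonempty I] (m : ℕ) (c : (I → ℕ) → I) :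
    ∃ x : I → ℕ, ∑ i, x i = m ∧ ∀ i, x i ≤ Fintype.card I ∨
      ∃ z : I → ℕ, ∑ i, z i = m ∧ c z = i ∧
        ∀ j, x j ≤ z j + Fintype.card I ∧ z j ≤ x j + Fintype.card I := by
  classical
  set n := Fintype.card I with hn
  obtain ⟨S, hd, hcard, hS⟩ := (SlackGrid.isSlack (I := I) m).exists_isDominant
    SlackGrid.order_injective (Sum.elim (fun x => c x.1) id) (fun _ => rfl)
  have mem_grid : ∀ x : {x // x ∈ piAntidiag (univ : Finset I) m}, ∑ i, x.1 i = m :=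
    fun x => (mem_piAntidiag.1 x.2).1
  -- For `i ∉ C` the slack point of `i` lies in `S` and imposes no bound on grid points; for `i ∈ C`
  -- the colour `i` must occur on the grid.
  let C : Finset I := univ.filter fun i => Sum.inr i ∉ S
  have memC : ∀ i, i ∈ C ↔ Sum.inr i ∉ S := fun i => by simp [C]
  -- every colour of `C` occurs at a point of the grid
  have hcol : ∀ i ∈ C, ∃ z : {x // x ∈ piAntidiag (univ : Finset I) m},
      Sum.inl z ∈ S ∧ c z.1 = i := by
    intro i hi
    obtain ⟨z | j, hz, hzi⟩ := hS i
    · exact ⟨z, hz, hzi⟩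
    · obtain rfl : j = i := hzi
      exact absurd hz ((memC j).1 hi)
  obtain ⟨i₁⟩ := ‹Nonempty I›
  let t : {x // x ∈ piAntidiag (univ : Finset I) m} :=
    ⟨Pi.single i₁ m, by simp [mem_piAntidiag]⟩
  obtain ⟨k, hk⟩ : C.Nonempty := by
    obtain ⟨i, hi⟩ := hd (Sum.inl t)
    refine ⟨i, (memC i).2 fun h => ?_⟩
    have := SlackGrid.coord_le_of_order_le (hi _ h)
    simp [SlackGrid.coord] at this
  obtain ⟨x, hxS, -⟩ := hcol k hk
  -- the minimal coordinates
  have hmin : ∀ i, ∃ a : ℕ, (i ∈ C → ∀ z, Sum.inl z ∈ S → a ≤ z.1 i) ∧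
      (i ∈ C → ∃ z, Sum.inl z ∈ S ∧ z.1 i = a) := by
    intro i
    obtain ⟨z, hz, hzmin⟩ := (univ.filter fun z => Sum.inl z ∈ S).exists_min_image
      (fun z : {x // x ∈ piAntidiag (univ : Finset I) m} => z.1 i) ⟨x, by simpa using hxS⟩
    exact ⟨z.1 i, fun _ w hw => hzmin w (by simpa using hw), fun _ => ⟨z, by simpa using hz, rfl⟩⟩
  choose a ha ha' using hmin
  -- Otherwise some grid point `y` exceeds each minimum `a i` on `C`, the surplus being put on `k`.
  -- It also exceeds the slack points of `S` in their own orders, contradicting dominance.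
  have hsum : m < ∑ i ∈ C, (a i + 1) := by
    by_contra! hle
    let y : I → ℕ := fun i => (if i ∈ C then a i + 1 else 0) +
      if i = k then m - ∑ i ∈ C, (a i + 1) else 0
    have hy : ∑ i, y i = m := by
      simp only [y, sum_add_distrib, sum_ite_mem, univ_inter, sum_ite_eq', mem_univ, if_true]
      rw [← sum_add_distrib]
      omega
    obtain ⟨i, hi⟩ := hd (Sum.inl ⟨y, by simp [mem_piAntidiag, hy]⟩)
    by_cases hiC : i ∈ C
    · obtain ⟨z, hz, hza⟩ := ha' i hiC
      have := SlackGrid.coord_le_of_order_le (hi _ hz)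
      simp only [SlackGrid.coord, hza, y, if_pos hiC] at this
      omega
    · have := SlackGrid.coord_le_of_order_le (hi _ (not_not.1 ((memC i).not.1 hiC)))
      simp [SlackGrid.coord] at this
  have hCn : C.card ≤ n := card_le_univ C
  have hsum' : m < ∑ i ∈ C, a i + n := by
    rw [sum_add_distrib, sum_const, smul_eq_mul, mul_one] at hsum
    omega
  have split : ∀ z : {x // x ∈ piAntidiag (univ : Finset I) m},
      ∑ i ∈ C, z.1 i + ∑ i ∈ Cᶜ, z.1 i = m := fun z => by
    rw [sum_add_sum_compl, mem_grid]
  -- The minima `a i` already use all but less than `n` of the total `m`, so no coordinate of a grid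
  -- point of `S` has more than `n` of freedom.
  have small : ∀ z, Sum.inl z ∈ S → ∀ i, i ∉ C → z.1 i ≤ n := by
    intro z hz i hi
    have h1 : ∑ i ∈ C, a i ≤ ∑ i ∈ C, z.1 i := sum_le_sum fun i hi => ha i hi z hz
    have h2 := single_le_sum (f := z.1) (fun _ _ => Nat.zero_le _) (mem_compl.2 hi)
    have h3 := split z
    omega
  have near : ∀ z, Sum.inl z ∈ S → ∀ i ∈ C, a i ≤ z.1 i ∧ z.1 i ≤ a i + n := by
    intro z hz i hi
    refine ⟨ha i hi z hz, ?_⟩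
    have h1 : ∑ i ∈ C.erase i, a i ≤ ∑ i ∈ C.erase i, z.1 i :=
      sum_le_sum fun i hi => ha i (mem_of_mem_erase hi) z hz
    have h2 := add_sum_erase C a hi
    have h3 := add_sum_erase C z.1 hi
    have h4 := split z
    omega
  refine ⟨x.1, mem_grid x, fun i => ?_⟩
  by_cases hi : i ∈ C
  · right
    obtain ⟨z, hz, hzi⟩ := hcol i hi
    refine ⟨z.1, mem_grid z, hzi, fun j => ?_⟩
    by_cases hj : j ∈ C
    · have h1 := near x hxS j hj
      have h2 := near z hz j hj
      omega
    · have h1 := small x hxS j hj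
      have h2 := small z hz j hj
      omega
  · exact Or.inl (small x hxS i hi)

end Grid

/-! ### The KKM lemma and Ky Fan's principle. -/

section KKM

open Finset

variable {I : Type*} [Fintype I]

theorem grid_mem_stdSimplex {m : ℕ} (hm : m ≠ 0) {x : I → ℕ} (hx : ∑ i, x i = m) :
    (fun i => (x i : ℝ) / m) ∈ stdSimplex ℝ I := by
  refine ⟨fun i => by positivity, ?_⟩
  rw [← sum_div, ← Nat.cast_sum, hx, div_self (by exact_mod_cast hm)]

/-- The **Knaster–Kuratowski–Mazurkiewicz lemma** for the standard simplex. -/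
theorem exists_mem_of_kkm [Nonempty I] (F : I → Set (I → ℝ)) (hF : ∀ i, IsClosed (F i))
    (hcover : ∀ p ∈ stdSimplex ℝ I, ∃ i, 0 < p i ∧ p ∈ F i) :
    ∃ p ∈ stdSimplex ℝ I, ∀ i, p ∈ F i := by
  classical
  by_contra! hcon
  have hFne : ∀ i, (F i).Nonempty := by
    intro i
    -- At a vertex only one coordinate is positive, so the vertex `i` lies in `F i`.
    obtain ⟨j, hj, hmem⟩ := hcover _ (single_mem_stdSimplex ℝ i)
    obtain rfl : j = i := by
      by_contra hji
      simp [hji] at hj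
    exact ⟨_, hmem⟩
  have hpos : ∀ i p, p ∉ F i → 0 < Metric.infDist p (F i) := fun i p hp =>
    ((hF i).notMem_iff_infDist_pos (hFne i)).1 hp
  have hne : (stdSimplex ℝ I).Nonempty :=
    ⟨_, single_mem_stdSimplex ℝ (Classical.arbitrary I)⟩
  -- a uniform lower bound for the greatest distance
  obtain ⟨δ, hδ, hfar⟩ : ∃ δ > 0, ∀ p ∈ stdSimplex ℝ I, ∃ i, δ ≤ Metric.infDist p (F i) := by
    obtain ⟨q, hq, hmin⟩ := (isCompact_stdSimplex ℝ I).exists_isMinOn hne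
      (f := fun p => univ.sup' univ_nonempty fun i => Metric.infDist p (F i))
      (Continuous.continuousOn (by
        refine Continuous.finset_sup'_apply _ fun i _ => Metric.continuous_infDist_pt _))
    obtain ⟨i, hi⟩ := hcon q hq
    refine ⟨_, (hpos i q hi).trans_le
      (le_sup' (fun i => Metric.infDist q (F i)) (mem_univ i)), fun p hp => ?_⟩
    obtain ⟨j, -, hj⟩ := exists_mem_eq_sup' univ_nonempty fun i => Metric.infDist p (F i)
    exact ⟨j, hj ▸ hmin hp⟩
  set n := Fintype.card I
  -- The covering hypothesis makes `φ` positive on the simplex; the grid points found below make its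
  -- minimum at most `n / m` for every `m`.
  let φ : (I → ℝ) → ℝ := fun p =>
    univ.sup' univ_nonempty fun i => min (δ - Metric.infDist p (F i)) (p i)
  have hφ : Continuous φ := by
    refine Continuous.finset_sup'_apply _ fun i _ => ?_
    exact (continuous_const.sub (Metric.continuous_infDist_pt _)).min (continuous_apply i)
  obtain ⟨q, hq, hmin⟩ := (isCompact_stdSimplex ℝ I).exists_isMinOn hne hφ.continuousOn
  have hsmall : ∀ m : ℕ, m ≠ 0 → φ q ≤ n / m := by
    intro m hm
    have hm0 : (0 : ℝ) < m := by exact_mod_cast Nat.pos_of_ne_zero hm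
    -- A grid point is coloured by a set at distance at least `δ`; colours off the grid are
    -- arbitrary.
    have : ∀ x : I → ℕ, ∃ i, ∑ i, x i = m → δ ≤ Metric.infDist (fun i => (x i : ℝ) / m) (F i) := by
      intro x
      by_cases hx : ∑ i, x i = m
      · exact (hfar _ (grid_mem_stdSimplex hm hx)).imp fun i hi _ => hi
      · exact ⟨Classical.arbitrary I, fun h => absurd h hx⟩
    choose c hc using this
    obtain ⟨x, hx, hxc⟩ := exists_near_all_colours m c
    refine (hmin (grid_mem_stdSimplex hm hx)).trans (sup'_le _ _ fun i _ => ?_)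
    rcases hxc i with h | ⟨z, hz, rfl, hnear⟩
    · refine (min_le_right _ _).trans ?_
      have : (x i : ℝ) ≤ n := by exact_mod_cast h
      exact div_le_div_of_nonneg_right this hm0.le
    · refine (min_le_left _ _).trans ?_
      have h1 := hc z hz
      have h2 := Metric.infDist_le_infDist_add_dist (s := F (c z))
        (x := fun i => (z i : ℝ) / m) (y := fun i => (x i : ℝ) / m)
      have h3 : dist (fun i => (z i : ℝ) / m) (fun i => (x i : ℝ) / m) ≤ n / m := by
        rw [dist_pi_le_iff (by positivity)]
        intro j
        rw [Real.dist_eq, ← sub_div, abs_div, abs_of_pos hm0]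
        gcongr
        rw [abs_le]
        have h4 : (x j : ℝ) ≤ z j + n := by exact_mod_cast (hnear j).1
        have h5 : (z j : ℝ) ≤ x j + n := by exact_mod_cast (hnear j).2
        constructor <;> linarith
      linarith
  have hφq : φ q ≤ 0 := by
    refine ge_of_tendsto (tendsto_const_div_atTop_nhds_zero_nat (n : ℝ)) ?_
    filter_upwards [Filter.eventually_ne_atTop 0] with m hm using hsmall m hm
  obtain ⟨i, hi, hqi⟩ := hcover q hq
  have := (le_sup' (fun i => min (δ - Metric.infDist q (F i)) (q i)) (mem_univ i)).trans hφq
  rw [Metric.infDist_zero_of_mem hqi, sub_zero] at this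
  exact absurd this (not_le.2 (lt_min hδ hi))

/-- Ky Fan's principle: a family of relations `P · y` with open sections on a compact convex set,
none of whose points `∑ i, p i • y i` satisfies `P · (y i)` for all `i` with `0 < p i`, fails
simultaneously at some point. -/
theorem IsCompact.exists_forall_not {E : Type*} [AddCommGroup E] [Module ℝ E] [TopologicalSpace E]
    [ContinuousAdd E] [ContinuousSMul ℝ E] {S A : Set E} (hS : IsCompact S) (hSne : S.Nonempty)
    (hSconv : Convex ℝ S) (hA : A ⊆ S) (P : E → E → Prop)
    (hopen : ∀ y ∈ A, ∃ U, IsOpen U ∧ ∀ x ∈ S, x ∈ U ↔ P x y)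
    (hP : ∀ (t : Finset E) (p : E → ℝ), (t : Set E) ⊆ A → (∀ y ∈ t, 0 ≤ p y) →
      ∑ y ∈ t, p y = 1 → ∃ y ∈ t, 0 < p y ∧ ¬ P (∑ z ∈ t, p z • z) y) :
    ∃ x ∈ S, ∀ y ∈ A, ¬ P x y := by
  by_contra! hcon
  have : ∀ y, ∃ U, IsOpen U ∧ (y ∈ A → ∀ x ∈ S, x ∈ U ↔ P x y) := by
    intro y
    by_cases hy : y ∈ A
    · exact (hopen y hy).imp fun U hU => ⟨hU.1, fun _ => hU.2⟩
    · exact ⟨∅, isOpen_empty, fun h => absurd h hy⟩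
  choose U hU hUP using this
  obtain ⟨t, htA, hfin, ht⟩ := hS.elim_finite_subcover_image (b := A) (c := U) (fun y _ => hU y)
    (fun x hx => by
      obtain ⟨y, hy, hxy⟩ := hcon x hx
      exact Set.mem_biUnion hy ((hUP y hy x hx).2 hxy))
  lift t to Finset E using hfin
  have htne : t.Nonempty := by
    obtain ⟨x, hx⟩ := hSne
    obtain ⟨y, hy, -⟩ := Set.mem_iUnion₂.1 (ht hx)
    exact ⟨y, hy⟩
  have : Nonempty t := htne.to_subtype
  let σ : (t → ℝ) → E := fun p => ∑ y : t, p y • (y : E)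
  have hσ : Continuous σ := by
    refine continuous_finsetSum _ fun y _ => ?_
    exact (continuous_apply y).smul continuous_const
  have hσS : ∀ p ∈ stdSimplex ℝ t, σ p ∈ S := fun p hp =>
    hSconv.sum_mem (fun y _ => hp.1 y) hp.2 fun y _ => hA (htA y.2)
  -- A point common to all these complements would be missed by the finite subcover.
  obtain ⟨p, hp, hpU⟩ := exists_mem_of_kkm (fun y : t => σ ⁻¹' (U y)ᶜ)
    (fun y => ((hU y).isClosed_compl).preimage hσ) (by
      classical
      intro p hp
      let q : E → ℝ := fun y => if h : y ∈ t then p ⟨y, h⟩ else 0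
      have hq : ∀ y : t, q y = p y := fun y => by simp [q]
      have hsum : ∑ y ∈ t, q y • y = σ p := by
        rw [← Finset.sum_coe_sort]
        simp only [hq, σ]
      obtain ⟨y, hy, hpos, hnot⟩ := hP t q htA
        (fun y hy => by rw [hq ⟨y, hy⟩]; exact hp.1 _)
        (by rw [← Finset.sum_coe_sort]; simp only [hq]; exact hp.2)
      refine ⟨⟨y, hy⟩, by rwa [← hq], ?_⟩
      rw [hsum] at hnot
      exact fun h => hnot ((hUP y (htA hy) _ (hσS p hp)).1 h))
  obtain ⟨y, hy, hmem⟩ := Set.mem_iUnion₂.1 (ht (hσS p hp))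
  exact hpU ⟨y, hy⟩ hmem

end KKM

/-! ### Cones with interior and `C`-convex maps. -/

section Cone

variable {Z : Type*} [AddCommGroup Z] [Module ℝ Z] [TopologicalSpace Z] [IsTopologicalAddGroup Z]
  {C : PointedCone ℝ Z}

theorem PointedCone.add_mem_interior {a c : Z} (ha : a ∈ interior (C : Set Z)) (hc : c ∈ C) :
    a + c ∈ interior (C : Set Z) := by
  have hsub : interior (C : Set Z) + {c} ⊆ C := by
    rintro _ ⟨x, hx, y, rfl, rfl⟩
    exact C.add_mem (interior_subset hx) hc
  exact interior_maximal hsub isOpen_interior.add_right (Set.add_mem_add ha rfl)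

/-- The set where a `C`-upper semicontinuous map takes values in `-interior C` is relatively
open. -/
theorem CUpperSemicontinuousAt.exists_forall_mem_neg_interior {E : Type*} [TopologicalSpace E]
    {K : Set E} {g : E → Z} {x : E} (hg : CUpperSemicontinuousAt (C : Set Z) K g x)
    (hx : g x ∈ -interior (C : Set Z)) :
    ∃ U ∈ 𝓝 x, ∀ u ∈ U ∩ K, g u ∈ -interior (C : Set Z) := by
  obtain ⟨U, hU, h⟩ := hg _ (isOpen_interior.neg.mem_nhds hx)
  refine ⟨U, hU, fun u hu => ?_⟩
  obtain ⟨v, hv, c, hc, hvc⟩ := h u hu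
  have := PointedCone.add_mem_interior (Set.mem_neg.1 hv) hc
  rw [← hvc, Set.mem_neg]
  simpa [sub_eq_add_neg, add_comm] using this

variable [ContinuousSMul ℝ Z]

theorem PointedCone.smul_mem_interior {t : ℝ} (ht : 0 < t) {a : Z}
    (ha : a ∈ interior (C : Set Z)) : t • a ∈ interior (C : Set Z) := by
  have hsub : t • interior (C : Set Z) ⊆ C := by
    rintro _ ⟨x, hx, rfl⟩
    exact C.smul_mem ht.le (interior_subset hx)
  exact interior_maximal hsub (isOpen_interior.smul₀ ht.ne') (Set.smul_mem_smul_set ha)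

/-- A cone that is a neighbourhood of zero absorbs every vector, so it is all of `Z` and cannot be
pointed. -/
theorem PointedCone.zero_notMem_interior [Nontrivial Z]
    (hC : (C : Set Z) ∩ -(C : Set Z) = {0}) : (0 : Z) ∉ interior (C : Set Z) := by
  intro h0
  have hall : ∀ z : Z, z ∈ C := by
    intro z
    have hcont : Filter.Tendsto (fun t : ℝ => t • z) (𝓝[>] 0) (𝓝 0) := by
      have : Continuous fun t : ℝ => t • z := continuous_id.smul continuous_const
      simpa using (this.tendsto 0).mono_left nhdsWithin_le_nhds
    obtain ⟨t, htz, ht⟩ := ((hcont.eventually (mem_interior_iff_mem_nhds.1 h0)).and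
      self_mem_nhdsWithin).exists
    have := C.smul_mem (inv_pos.2 ht).le htz
    rwa [smul_smul, inv_mul_cancel₀ (ne_of_gt ht), one_smul] at this
  obtain ⟨z, hz⟩ := exists_ne (0 : Z)
  have : z ∈ (C : Set Z) ∩ -(C : Set Z) := ⟨hall z, hall (-z)⟩
  rw [hC] at this
  exact hz this

theorem PointedCone.notMem_neg_interior [Nontrivial Z]
    (hC : (C : Set Z) ∩ -(C : Set Z) = {0}) {c : Z} (hc : c ∈ C) :
    c ∉ -interior (C : Set Z) := by
  intro h
  have h' : -c ∈ interior (C : Set Z) := h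
  have hmem : c ∈ (C : Set Z) ∩ -(C : Set Z) := ⟨hc, Set.mem_neg.2 (interior_subset h')⟩
  rw [hC, Set.mem_singleton_iff] at hmem
  rw [hmem, neg_zero] at h'
  exact zero_notMem_interior hC h'

theorem CConvexOn.sum_smul_sub_mem {E Z ι : Type*} [AddCommGroup E] [Module ℝ E] [AddCommGroup Z]
    [Module ℝ Z] {C : Set Z} {K : Set E} {g : E → Z} (hg : CConvexOn C K g) (hK : Convex ℝ K)
    (t : Finset ι) (p : ι → ℝ) (y : ι → E) (hp : ∀ i ∈ t, 0 ≤ p i) (hsum : ∑ i ∈ t, p i = 1)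
    (hy : ∀ i ∈ t, y i ∈ K) : ∑ i ∈ t, p i • g (y i) - g (∑ i ∈ t, p i • y i) ∈ C := by
  have h := hg t.card (fun j => y (t.equivFin.symm j)) (fun j => p (t.equivFin.symm j))
    (fun j => hy _ (t.equivFin.symm j).2) (fun j => hp _ (t.equivFin.symm j).2)
  rw [t.equivFin.symm.sum_comp fun i : t => p i,
    t.equivFin.symm.sum_comp fun i : t => p i • y i,
    t.equivFin.symm.sum_comp fun i : t => p i • g (y i),
    t.sum_coe_sort p, t.sum_coe_sort fun i => p i • y i, t.sum_coe_sort fun i => p i • g (y i)] at h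
  exact h hsum (hK.sum_mem hp hsum hy)

/-- Among finitely many points weighted by a convex combination, a `C`-convex map vanishing at the
combination takes at some point of positive weight a value outside `-interior C`. -/
theorem CConvexOn.exists_notMem_neg_interior [Nontrivial Z]
    (hC : (C : Set Z) ∩ -(C : Set Z) = {0}) {E ι : Type*} [AddCommGroup E] [Module ℝ E]
    {K : Set E} {g : E → Z} (hg : CConvexOn (C : Set Z) K g) (hK : Convex ℝ K) (t : Finset ι)
    (p : ι → ℝ) (y : ι → E) (hp : ∀ i ∈ t, 0 ≤ p i) (hsum : ∑ i ∈ t, p i = 1)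
    (hy : ∀ i ∈ t, y i ∈ K) (h0 : g (∑ i ∈ t, p i • y i) = 0) :
    ∃ i ∈ t, 0 < p i ∧ g (y i) ∉ -interior (C : Set Z) := by
  by_contra! hcon
  have hmem := hg.sum_smul_sub_mem hK t p y hp hsum hy
  rw [h0, sub_zero] at hmem
  -- Terms of zero weight are dropped because nothing is known about their values. The remaining
  -- convex combination lies in both `C` and `-interior C`, which is impossible.
  have hfilter : ∀ i ∈ t, p i ≠ 0 → 0 < p i := fun i hi h => lt_of_le_of_ne (hp i hi) h.symm
  have hsub := Finset.sum_filter_of_ne (s := t) (f := p) (p := fun i => 0 < p i) hfilter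
  have hsub' := Finset.sum_filter_of_ne (s := t) (f := fun i => p i • g (y i))
    (p := fun i => 0 < p i) fun i hi h => hfilter i hi fun h' => h (by rw [h', zero_smul])
  have hconv : Convex ℝ (-interior (C : Set Z)) := (C.toConvexCone.convex.interior).neg
  refine PointedCone.notMem_neg_interior hC hmem (hsub' ▸ hconv.sum_mem
    (fun i hi => (Finset.mem_filter.1 hi).2.le) (hsub.trans hsum) fun i hi => ?_)
  exact hcon i (Finset.mem_filter.1 hi).1 (Finset.mem_filter.1 hi).2

/-- If `g` is `C`-convex, `g a = 0` and `g b ∈ -interior C`, then `g` takes values in `-interior C`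
on the half-open segment from `a` to `b`. -/
theorem CConvexOn.mem_neg_interior {E : Type*} [AddCommGroup E] [Module ℝ E]
    {K : Set E} {g : E → Z} (hg : CConvexOn (C : Set Z) K g) (hK : Convex ℝ K) {a b : E}
    (ha : a ∈ K) (hb : b ∈ K) (ha0 : g a = 0) (hgb : g b ∈ -interior (C : Set Z)) {t : ℝ}
    (ht0 : 0 < t) (ht1 : t ≤ 1) : g ((1 - t) • a + t • b) ∈ -interior (C : Set Z) := by
  have h := hg.sum_smul_sub_mem hK Finset.univ ![1 - t, t] ![a, b]
    (by simp [Fin.forall_fin_two, ht0.le, ht1]) (by simp) (by simp [Fin.forall_fin_two, ha, hb])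
  simp only [Fin.sum_univ_two, Matrix.cons_val_zero, Matrix.cons_val_one, ha0, smul_zero,
    zero_add] at h
  have := PointedCone.add_mem_interior
    (PointedCone.smul_mem_interior ht0 (Set.mem_neg.1 hgb)) h
  rw [Set.mem_neg]
  simpa [sub_eq_add_neg] using this

end Cone

/-! ### Weak compactness, and norm density of `D`. -/

section Weak

variable {X : Type*} [NormedAddCommGroup X] [NormedSpace ℝ X]

/-- In a reflexive space, bounded closed convex sets are weakly compact. -/
theorem IsReflexiveNormedSpace.isCompact_image_toWeakSpace (hX : IsReflexiveNormedSpace X)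
    {S : Set X} (hS : IsClosed S) (hconv : Convex ℝ S) (hb : Bornology.IsBounded S) :
    IsCompact (toWeakSpace ℝ X '' S) := by
  have := NormedSpace.isCompact_closure_of_isBounded ℝ X (toWeakSpace ℝ X '' S)
    (by rwa [Set.preimage_image_eq _ (toWeakSpace ℝ X).injective])
    (by
      intro φ _
      obtain ⟨x, hx⟩ := hX (WeakDual.toStrongDual φ)
      refine ⟨toWeakSpace ℝ X x, ?_⟩
      exact DFunLike.ext _ _ fun l => congrArg (fun ψ => ψ l) hx)
  rwa [← hconv.toWeakSpace_closure ℝ, hS.closure_eq] at this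

/-- A point in the weak closure of a relatively compact set is in its norm closure. -/
theorem mem_closure_of_mem_weak_closure {S : Set X} (hS : IsCompact (closure S)) {p : X}
    (h : toWeakSpace ℝ X p ∈ closure (toWeakSpace ℝ X '' S)) : p ∈ closure S := by
  have hclosed : IsClosed (toWeakSpace ℝ X '' closure S) :=
    (hS.image (toWeakSpaceCLM ℝ X).continuous).isClosed
  exact (toWeakSpace ℝ X).injective.mem_set_image.1
    (closure_minimal (Set.image_mono subset_closure) hclosed h)

/-- A set which is self-segment-dense in the weak topology is norm dense. -/
theorem SelfSegmentDense.subset_norm_closure {D K : Set X}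
    (hD : SelfSegmentDense (toWeakSpace ℝ X '' D) (toWeakSpace ℝ X '' K)) : K ⊆ closure D := by
  -- A segment is norm compact, so weak density in it is norm density. This makes `closure D`
  -- convex, hence weakly closed, and weak density of `D` in `K` becomes norm density.
  have hseg : ∀ x ∈ D, ∀ y ∈ D, segment ℝ x y ⊆ closure D := by
    intro x hx y hy p hp
    have himg : segment ℝ (toWeakSpace ℝ X x) (toWeakSpace ℝ X y) =
        toWeakSpace ℝ X '' segment ℝ x y :=
      (image_segment ℝ (toWeakSpace ℝ X).toLinearMap.toAffineMap x y).symm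
    have := hD.segment_dense _ (Set.mem_image_of_mem _ hx) _ (Set.mem_image_of_mem _ hy)
    rw [himg, ← Set.image_inter (toWeakSpace ℝ X).injective] at this
    have hcpt : IsCompact (segment ℝ x y) := by
      rw [segment_eq_image_lineMap]
      exact isCompact_Icc.image AffineMap.lineMap_continuous
    exact closure_mono Set.inter_subset_right (mem_closure_of_mem_weak_closure
      (hcpt.closure_of_subset Set.inter_subset_left) (this (Set.mem_image_of_mem _ hp)))
  have hconv : Convex ℝ (closure D) := by
    intro x hx y hy a b ha hb hab
    have hcont : Continuous fun q : X × X => a • q.1 + b • q.2 := by fun_prop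
    have hmem : (x, y) ∈ closure (D ×ˢ D) := by
      rw [closure_prod_eq]; exact ⟨hx, hy⟩
    have := map_mem_closure hcont hmem (t := closure D) fun q hq =>
      hseg q.1 hq.1 q.2 hq.2 ⟨a, b, ha, hb, hab, rfl⟩
    rwa [closure_closure] at this
  intro x hx
  have h1 := hD.dense (Set.mem_image_of_mem _ hx)
  have h2 := closure_mono (Set.image_mono (f := toWeakSpace ℝ X) (subset_closure : D ⊆ closure D)) h1
  rw [← hconv.toWeakSpace_closure ℝ, closure_closure] at h2
  exact (toWeakSpace ℝ X).injective.mem_set_image.1 h2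

end Weak

/-! ### The main theorem. -/

theorem theoremt12 {X Z : Type*}
    [NormedAddCommGroup X] [NormedSpace ℝ X] [CompleteSpace X]
    (hX : IsReflexiveNormedSpace X)
    [AddCommGroup Z] [Module ℝ Z] [TopologicalSpace Z] [IsTopologicalAddGroup Z]
    [ContinuousSMul ℝ Z] [LocallyConvexSpace ℝ Z] [T2Space Z] [Nontrivial Z]
    -- `PointedCone` is a convex cone that contains `0`
    (C : PointedCone ℝ Z)
    (hCpointed : (C : Set Z) ∩ -(C : Set Z) = {0})
    (hCint : (interior (C : Set Z)).Nonempty)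
    (K D : Set X) (hKne : K.Nonempty) (hKconv : Convex ℝ K) (hKclosed : IsClosed K)
    (hD : SelfSegmentDense (toWeakSpace ℝ X '' D) (toWeakSpace ℝ X '' K))
    -- only the values of `f` on `K × K` matter
    (f : X → X → Z)
    (h1 : ∀ y ∈ D, ∀ x ∈ K, WeaklyCUpperSemicontinuousAt (C : Set Z) K (fun x' => f x' y) x)
    (h2 : ∀ x ∈ K, ∀ y ∈ K \ D,
      WeaklyCUpperSemicontinuousAt (C : Set Z) K (fun y' => f x y') y)
    (h3 : ∀ x ∈ K, CConvexOn (C : Set Z) K (fun y => f x y))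
    (h4 : ∀ x ∈ K, f x x = 0)
    (h5 : ∃ r : ℝ, 0 < r ∧ ∀ x ∈ K, r < ‖x‖ → ∃ y₀ ∈ K, ‖y₀‖ < ‖x‖ ∧
      f x y₀ ∈ -interior (C : Set Z) ∪ {0}) :
    ∃ x₀ ∈ K, ∀ y ∈ K, f x₀ y ∉ -interior (C : Set Z) := by
  obtain ⟨r, -, hr⟩ := h5
  obtain ⟨k, hk⟩ := hKne
  -- `R > r` lets coercivity act on the sphere of radius `R`; `R > ‖k‖` keeps the truncated set
  -- nonempty.
  obtain ⟨R, hrR, hkR⟩ : ∃ R, r < R ∧ ‖k‖ < R :=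
    ⟨max r ‖k‖ + 1, (le_max_left _ _).trans_lt (lt_add_one _),
      (le_max_right _ _).trans_lt (lt_add_one _)⟩
  let w := toWeakSpace ℝ X
  have hDK : ∀ y ∈ D, y ∈ K := fun y hy =>
    w.injective.mem_set_image.1 (hD.subset (Set.mem_image_of_mem _ hy))
  have hnorm : K ⊆ closure D := hD.subset_norm_closure
  have hconv : Convex ℝ (K ∩ Metric.closedBall 0 R) := hKconv.inter (convex_closedBall 0 R)
  have hcompact : IsCompact (w '' (K ∩ Metric.closedBall 0 R)) :=
    hX.isCompact_image_toWeakSpace (hKclosed.inter Metric.isClosed_closedBall) hconv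
      (Metric.isBounded_closedBall.subset Set.inter_subset_right)
  -- a solution on the ball for the points of `D`
  obtain ⟨x₀, ⟨hx₀, hx₀R⟩, hsol⟩ : ∃ x ∈ K ∩ Metric.closedBall 0 R,
      ∀ y ∈ D ∩ Metric.ball 0 R, f x y ∉ -interior (C : Set Z) := by
    obtain ⟨_, ⟨x, hx, rfl⟩, h⟩ := hcompact.exists_forall_not
      (A := w '' (D ∩ Metric.ball 0 R))
      ⟨w k, k, ⟨hk, by simpa using hkR.le⟩, rfl⟩ (hconv.linear_image w.toLinearMap)
      (Set.image_mono (Set.inter_subset_inter hDK Metric.ball_subset_closedBall))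
      (fun x y => f (w.symm x) (w.symm y) ∈ -interior (C : Set Z))
      (by
        rintro _ ⟨y, hy, rfl⟩
        -- The implication admits all points outside `K`, so semicontinuity relative to `K` yields a
        -- set open in the whole weak space.
        refine ⟨interior {x | x ∈ w '' K → f (w.symm x) y ∈ -interior (C : Set Z)},
          isOpen_interior, ?_⟩
        rintro _ ⟨x, hx, rfl⟩
        rw [w.symm_apply_apply, w.symm_apply_apply]
        constructor
        · intro h
          simpa using interior_subset h (Set.mem_image_of_mem _ hx.1)
        · intro h
          obtain ⟨U, hU, hUC⟩ := CUpperSemicontinuousAt.exists_forall_mem_neg_interior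
            (h1 y hy.1 x hx.1) (by simpa using h)
          rw [mem_interior_iff_mem_nhds]
          filter_upwards [hU] with u hu huK using hUC u ⟨hu, huK⟩)
      (by
        intro t p ht hp hsum
        have hmem : ∀ y ∈ t, w.symm y ∈ K := by
          intro y hy
          obtain ⟨z, hz, rfl⟩ := ht hy
          simpa using hDK z hz.1
        have hsym : w.symm (∑ y ∈ t, p y • y) = ∑ y ∈ t, p y • w.symm y := by
          simp only [map_sum, map_smul]
        have hx : ∑ y ∈ t, p y • w.symm y ∈ K := hKconv.sum_mem hp hsum hmem
        rw [hsym]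
        exact (h3 _ hx).exists_notMem_neg_interior hCpointed hKconv t p _ hp hsum hmem (h4 _ hx))
    refine ⟨x, hx, fun y hy => ?_⟩
    simpa using h _ (Set.mem_image_of_mem _ hy)
  -- by density, a solution on the ball
  have hball : ∀ y ∈ K, ‖y‖ < R → f x₀ y ∉ -interior (C : Set Z) := by
    intro y hy hyR hcon
    by_cases hyD : y ∈ D
    · exact hsol y ⟨hyD, by simpa using hyR⟩ hcon
    obtain ⟨U, hU, hUC⟩ := CUpperSemicontinuousAt.exists_forall_mem_neg_interior
      (h2 x₀ hx₀ y ⟨hy, hyD⟩) (by simpa using hcon)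
    -- The ball need not be weakly open, so weak density of `D` would not suffice here; norm density
    -- does.
    have hU' : w ⁻¹' U ∩ Metric.ball 0 R ∈ 𝓝 y :=
      Filter.inter_mem ((toWeakSpaceCLM ℝ X).continuous.continuousAt hU)
        (Metric.isOpen_ball.mem_nhds (by simpa using hyR))
    obtain ⟨z, ⟨hzU, hzR⟩, hzD⟩ := mem_closure_iff_nhds.1 (hnorm hy) _ hU'
    refine hsol z ⟨hzD, hzR⟩ ?_
    simpa [w] using hUC (w z) ⟨hzU, Set.mem_image_of_mem _ (hDK z hzD)⟩
  -- by coercivity, a solution on `K`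
  obtain ⟨y₀, hy₀, hy₀R, hfy₀⟩ : ∃ y₀ ∈ K, ‖y₀‖ < R ∧ f x₀ y₀ = 0 := by
    rcases (mem_closedBall_zero_iff.1 hx₀R).lt_or_eq with hlt | heq
    · exact ⟨x₀, hx₀, hlt, h4 x₀ hx₀⟩
    · obtain ⟨y₀, hy₀, hlt, h⟩ := hr x₀ hx₀ (heq ▸ hrR)
      have hlt' : ‖y₀‖ < R := heq ▸ hlt
      -- Since `y₀` is in the open ball, the value in `-interior C` is already excluded, leaving
      -- zero.
      exact ⟨y₀, hy₀, hlt', h.resolve_left (hball y₀ hy₀ hlt')⟩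
  refine ⟨x₀, hx₀, fun y hy hcon => ?_⟩
  have hcont : Filter.Tendsto (fun t : ℝ => ‖(1 - t) • y₀ + t • y‖) (𝓝[>] 0) (𝓝 ‖y₀‖) := by
    have : Continuous fun t : ℝ => ‖(1 - t) • y₀ + t • y‖ := by fun_prop
    simpa using (this.tendsto 0).mono_left nhdsWithin_le_nhds
  obtain ⟨t, ht, ht0, ht1⟩ := ((hcont.eventually_lt_const hy₀R).and
    (Ioc_mem_nhdsGT (zero_lt_one' ℝ))).exists
  exact hball _ (hKconv hy₀ hy (sub_nonneg.2 ht1) ht0.le (sub_add_cancel _ _)) ht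
    ((h3 x₀ hx₀).mem_neg_interior hKconv hy₀ hy hfy₀ hcon ht0 ht1)
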